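/- Fix a finite algebraic signature (finitely many function symbols, constants allowed, no relation symbols). Let $\mathcal V$ be the variety of all algebras satisfying some set $\Lambda$ of equational laws, and assume that $\mathcal V$ is nontrivial, i.e. contains an algebra with at least two elements. For a set $R$ of equations between terms over $X_n=\{x_0,\dots,x_{n-1}\}$, let $\langle X_n\mid R\rangle_{\mathcal V}$ be the quotient of the term algebra over $X_n$ by the smallest congruence containing $R$ and all instances of the laws in $\Lambda$. Fix a standard effective coding of equations by natural numbers, let $W_e$ be the $e$-th computably enumerable set, and let $\mathcal V_n[e]=\langle X_n\mid W_e\rangle_{\mathcal V}$, where $W_e$ stands for the set of equations over $X_n$ whose codes lie in $W_e$. Let $\cong_{\mathcal V_n}$ be the equivalence relation on $\mathbb N$ given by $$e\cong_{\mathcal V_n} i\iff \mathcal V_n[e]\cong\mathcal V_n[i].$$ For equivalence relations $E,F$ on $\mathbb N$, write $E\le_c F$ if there is a computable function $h:\mathbb N\to\mathbb N$ with $x\,E\,y\iff h(x)\,F\,h(y)$ for all $x,y$, and $E<_cF$ if $E\le_cF$ and $F\not\le_cE$. **Theorem.** Suppose that 1. for all $k\ge 1$ and all $e$, the congruences of $\mathcal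 V_k[e]$, ordered by inclusion, satisfy the ascending chain condition (every ascending sequence is eventually constant); and 2. the isomorphism problem for finite presentations in $\mathcal V$ is decidable: there is an algorithm which, given $k,l\ge 1$ and finite sets $R$, $S$ of equations over $X_k$ and over $X_l$ respectively, decides whether $\langle X_k\mid R\rangle_{\mathcal V}\cong\langle X_l\mid S\rangle_{\mathcal V}$. Then $\cong_{\mathcal V_n}\,<_c\,\cong_{\mathcal V_{n+1}}$ for every $n\ge 1$. -/

import Mathlib

universe u v w

open scoped FirstOrder

namespace CeAlgebra

/-! ### Computability -/

/-- `W e` is the `e`-th computably enumerable set: the domain of the `e`-th partial computable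
function. -/
def W (e : ℕ) : Set ℕ :=
  {x | ((Denumerable.ofNat Nat.Partrec.Code e).eval x).Dom}

/-- Computable reducibility of equivalence relations on the natural numbers. -/
def ComputablyReducible (E F : Setoid ℕ) : Prop :=
  ∃ h : ℕ → ℕ, Computable h ∧ ∀ x y : ℕ, E x y ↔ F (h x) (h y)

/-- `E` is strictly below `F` with respect to computable reducibility. -/
def StrictlyBelow (E F : Setoid ℕ) : Prop :=
  ComputablyReducible E F ∧ ¬ ComputablyReducible F E

section Algebra

variable {L : FirstOrder.Language.{u, v}}

/-! ### Congruences and the ascending chain condition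

An algebra is a structure for a language without relation symbols. -/

/-- A congruence: an equivalence relation compatible with all operations. -/
def IsCongruence {A : Type w} [L.Structure A] (s : Setoid A) : Prop :=
  ∀ {k : ℕ} (f : L.Functions k) (a b : Fin k → A), (∀ i, s (a i) (b i)) →
    s (FirstOrder.Language.Structure.funMap f a) (FirstOrder.Language.Structure.funMap f b)

variable (L) in
/-- The set of congruences of an algebra, ordered by inclusion. -/
abbrev CongruenceLattice (A : Type w) [L.Structure A] : Type w :=
  {s : Setoid A // IsCongruence (L := L) s}

variable (L) in
/-- The ascending chain condition: every ascending sequence of congruences is eventually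
constant. -/
def HasACC (A : Type w) [L.Structure A] : Prop :=
  ∀ p : ℕ →o CongruenceLattice L A, ∃ n, ∀ m, n ≤ m → p n = p m

/-! ### Varieties and presentations

A variety is given by a set `Λ` of equational laws, i.e. of pairs of terms in the variables
`0, 1, 2, …`. -/

/-- The algebra `A` belongs to the variety defined by the laws `Λ`. -/
def InVariety (Λ : Set (L.Term ℕ × L.Term ℕ)) (A : Type w) [L.Structure A] : Prop :=
  ∀ q ∈ Λ, ∀ a : ℕ → A, q.1.realize a = q.2.realize a

/-- The term algebra over `X` (there are no relation symbols to interpret). -/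
instance termAlgebra [L.IsAlgebraic] (X : Type w) : L.Structure (L.Term X) where
  funMap f ts := FirstOrder.Language.Term.func f ts
  RelMap r _ := isEmptyElim r

/-- The smallest congruence on the term algebra over `X` that contains the equations `R` and all
instances of the laws `Λ`. -/
def presCongr [L.IsAlgebraic] (Λ : Set (L.Term ℕ × L.Term ℕ)) {X : Type w}
    (R : Set (L.Term X × L.Term X)) : Setoid (L.Term X) :=
  sInf {s | IsCongruence (L := L) s ∧ (∀ p ∈ R, s p.1 p.2) ∧
    ∀ q ∈ Λ, ∀ t : ℕ → L.Term X, s (q.1.subst t) (q.2.subst t)}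

theorem presCongr_isCongruence [L.IsAlgebraic] (Λ : Set (L.Term ℕ × L.Term ℕ)) {X : Type w}
    (R : Set (L.Term X × L.Term X)) : IsCongruence (L := L) (presCongr Λ R) := by
  intro k f a b hab s hs
  exact hs.1 f a b fun i => hab i s hs

instance presPrestructure [L.IsAlgebraic] (Λ : Set (L.Term ℕ × L.Term ℕ)) {X : Type w}
    (R : Set (L.Term X × L.Term X)) : L.Prestructure (presCongr Λ R) where
  toStructure := termAlgebra X
  fun_equiv := fun {_ f} x y h => presCongr_isCongruence Λ R f x y h
  rel_equiv := fun {_ r} _ _ _ => isEmptyElim r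

/-- The algebra presented in the variety of `Λ` by the generators `X` and the equations `R`: the
quotient of the term algebra by `presCongr Λ R`. Its operations are those of Mathlib's quotient
structure. -/
abbrev Presented [L.IsAlgebraic] (Λ : Set (L.Term ℕ × L.Term ℕ)) {X : Type w}
    (R : Set (L.Term X × L.Term X)) : Type (max u w) :=
  Quotient (presCongr Λ R)

/-! ### Coding

The signature is finite; `ε` numbers its function symbols. -/

variable {m : ℕ} (ε : (Σ k, L.Functions k) ≃ Fin m)

/-- The Gödel number of a term over the generators `x₀, …, xₙ₋₁`: the code of the list of symbols
(generators and function symbols) that is the Polish notation of the term. -/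
def termCode {n : ℕ} (t : L.Term (Fin n)) : ℕ :=
  Encodable.encode (t.listEncode.map (Sum.map id ε) : List (Fin n ⊕ Fin m))

/-- The Gödel number of an equation. -/
def eqCode {n : ℕ} (p : L.Term (Fin n) × L.Term (Fin n)) : ℕ :=
  Nat.pair (termCode ε p.1) (termCode ε p.2)

/-- The algebra presented in the variety of `Λ` by the generators `x₀, …, xₙ₋₁` and the equations
whose Gödel numbers belong to `S`. -/
abbrev AlgebraOn [L.IsAlgebraic] (Λ : Set (L.Term ℕ × L.Term ℕ)) (n : ℕ) (S : Set ℕ) : Type u :=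
  Presented Λ {p : L.Term (Fin n) × L.Term (Fin n) | eqCode ε p ∈ S}

/-- The isomorphism relation on the `n`-generated c.e. algebras of the variety of `Λ`: `e` and `i`
are related if the algebras with generators `x₀, …, xₙ₋₁` presented by `W e` and by `W i` are
isomorphic. -/
def isoRel [L.IsAlgebraic] (Λ : Set (L.Term ℕ × L.Term ℕ)) (n : ℕ) : Setoid ℕ where
  r e i := Nonempty (AlgebraOn ε Λ n (W e) ≃[L] AlgebraOn ε Λ n (W i))
  iseqv :=
    { refl := fun _ => ⟨FirstOrder.Language.Equiv.refl L _⟩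
      symm := fun ⟨φ⟩ => ⟨φ.symm⟩
      trans := fun ⟨φ⟩ ⟨ψ⟩ => ⟨ψ.comp φ⟩ }

/-- The finitely generated c.e. algebras of the variety of `Λ` have the ascending chain condition on
congruences. -/
def FinitelyGeneratedACC [L.IsAlgebraic] (Λ : Set (L.Term ℕ × L.Term ℕ)) : Prop :=
  ∀ k e : ℕ, 1 ≤ k → HasACC L (AlgebraOn ε Λ k (W e))

/-- The isomorphism problem for finite presentations in the variety of `Λ` is decidable. A finite
presentation is given by its number of generators and a finite list of Gödel numbers of
equations. -/
def DecidableIsoProblem [L.IsAlgebraic] (Λ : Set (L.Term ℕ × L.Term ℕ)) : Prop :=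
  ∃ d : (ℕ × List ℕ) × (ℕ × List ℕ) → Bool, Computable d ∧
    ∀ (k l : ℕ) (R S : List ℕ), 1 ≤ k → 1 ≤ l →
      (d ((k, R), (l, S)) = true ↔
        Nonempty (AlgebraOn ε Λ k {c | c ∈ R} ≃[L] AlgebraOn ε Λ l {c | c ∈ S}))

end Algebra

end CeAlgebra

/-! Write `A e` for the algebra presented by `W e` on `n + 1` generators and `B j` for the one
presented by `W j` on `n` generators. An `n`-generated algebra becomes an `(n + 1)`-generated one by
adding a generator and equating it with `x₀`; this is effective, which gives
`computablyReducible_isoRel_succ`.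

Conversely, let `h` reduce the relation for `n + 1` to that for `n`. Call `e` bad if some surjection
`φ : A e → B (h e)` is not injective. An index of the empty set is bad: nontriviality separates the
extra generator of the free algebra from `x₀` (`exists_surjective_not_injective`). By
`exists_presCongr_lt` a bad `e` yields a bad `i` with a strictly larger congruence on the term
algebra, which contradicts the chain condition.

To find `i`, use the recursion theorem: `W i` copies a finite presentation of `A e` until some
finite stage of `W (h i)` presents a copy of `B (h e)`, and then adds the kernel of `φ`. Such a
stage must appear, since otherwise `A i ≅ A e`, so `B (h i) ≅ B (h e)`, and by the chain condition a
finite stage already presents `B (h i)`. Hence `A i ≅ B (h e)`, and `B (h i)` is a quotient of `B (h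
e)`. The quotient is proper: otherwise `A e ≅ A i ≅ A e / ker φ`, although `A e` is Hopfian. -/

namespace CeAlgebra

open FirstOrder FirstOrder.Language FirstOrder.Language.Structure
open Nat.Partrec (Code)

/-! ### Presented algebras, their universal property, and Hopficity from the chain condition -/

section Presentations

variable {L : FirstOrder.Language.{u, v}}

/-- A bijective homomorphism of algebras is an isomorphism. -/
noncomputable def equivOfBijective [L.IsAlgebraic] {A B : Type*} [L.Structure A] [L.Structure B]
    (φ : A →[L] B) (h : Function.Bijective φ) : A ≃[L] B where
  toEquiv := _root_.Equiv.ofBijective φ h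
  map_fun' f x := φ.map_fun f x
  map_rel' r _ := isEmptyElim r

/-- The kernel of a homomorphism is a congruence. -/
theorem isCongruence_ker {A B : Type*} [L.Structure A] [L.Structure B] (φ : A →[L] B) :
    IsCongruence (L := L) (Setoid.ker φ) := by
  intro k f a b h
  change φ _ = φ _
  rw [φ.map_fun, φ.map_fun]
  congr 1
  exact funext h

/-- An algebra with the ascending chain condition on congruences is Hopfian. -/
theorem HasACC.injective_of_surjective {A : Type*} [L.Structure A] (hA : HasACC L A)
    (φ : A →[L] A) (hφ : Function.Surjective φ) : Function.Injective φ := by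
  have hom : ∀ k : ℕ, ∃ ψ : A →[L] A, (ψ : A → A) = φ^[k] := by
    intro k
    induction k with
    | zero => exact ⟨Hom.id L A, rfl⟩
    | succ k ih =>
      obtain ⟨ψ, hψ⟩ := ih
      refine ⟨ψ.comp φ, ?_⟩
      funext x
      simp [hψ, Function.iterate_succ]
  have cong : ∀ k : ℕ, IsCongruence (L := L) (Setoid.ker (φ^[k])) := by
    intro k
    obtain ⟨ψ, hψ⟩ := hom k
    rw [← hψ]
    exact isCongruence_ker ψ
  have mono : Monotone fun k => (⟨Setoid.ker (φ^[k]), cong k⟩ : CongruenceLattice L A) := by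
    refine monotone_nat_of_le_succ fun k x y hxy => ?_
    change φ^[k] x = φ^[k] y at hxy
    change φ^[k + 1] x = φ^[k + 1] y
    rw [Function.iterate_succ_apply', Function.iterate_succ_apply', hxy]
  obtain ⟨k, hk⟩ := hA ⟨_, mono⟩
  intro x y hxy
  -- With the kernels of `φ^[k]` and `φ^[k + 1]` equal, pulling `x` and `y` back along the
  -- surjection `φ^[k]` turns `φ x = φ y` into a relation in the larger kernel.
  obtain ⟨a, rfl⟩ := hφ.iterate k x
  obtain ⟨b, rfl⟩ := hφ.iterate k y
  have h1 : Setoid.ker (φ^[k]) = Setoid.ker (φ^[k + 1]) :=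
    congrArg Subtype.val (hk (k + 1) k.le_succ)
  have h2 : Setoid.ker (φ^[k + 1]) a b := by
    change φ^[k + 1] a = φ^[k + 1] b
    rw [Function.iterate_succ_apply', Function.iterate_succ_apply', hxy]
  rw [← h1] at h2
  exact h2

variable [L.IsAlgebraic] (Λ : Set (L.Term ℕ × L.Term ℕ)) {X : Type*}

/-- The congruences of the term algebra whose quotient satisfies the laws. -/
def IsLawfulCongruence (s : Setoid (L.Term X)) : Prop :=
  IsCongruence (L := L) s ∧ ∀ q ∈ Λ, ∀ t : ℕ → L.Term X, s (q.1.subst t) (q.2.subst t)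

variable {Λ}

theorem presCongr_of_mem {R : Set (L.Term X × L.Term X)} {p : L.Term X × L.Term X} (hp : p ∈ R) :
    presCongr Λ R p.1 p.2 :=
  fun _ hs => hs.2.1 p hp

theorem isLawfulCongruence_presCongr (R : Set (L.Term X × L.Term X)) :
    IsLawfulCongruence Λ (presCongr Λ R) :=
  ⟨presCongr_isCongruence Λ R, fun q hq t _ hs => hs.2.2 q hq t⟩

theorem presCongr_le {R : Set (L.Term X × L.Term X)} {s : Setoid (L.Term X)}
    (hs : IsLawfulCongruence Λ s) (hR : ∀ p ∈ R, s p.1 p.2) : presCongr Λ R ≤ s :=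
  sInf_le ⟨hs.1, hR, hs.2⟩

theorem presCongr_mono {R S : Set (L.Term X × L.Term X)} (h : R ⊆ S) :
    presCongr Λ R ≤ presCongr Λ S :=
  presCongr_le (isLawfulCongruence_presCongr S) fun _ hp => presCongr_of_mem (h hp)

theorem realize_termAlgebra {Y : Type*} (t : L.Term Y) (v : Y → L.Term X) :
    t.realize v = t.subst v := by
  induction t with
  | var => rfl
  | func f ts ih => simp only [Term.realize, Term.subst, ih]; rfl

theorem realize_mk {Y : Type*} (R : Set (L.Term X × L.Term X)) (t : L.Term Y) (v : Y → L.Term X) :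
    t.realize (fun y => (⟦v y⟧ : Presented Λ R)) = ⟦t.subst v⟧ := by
  rw [← realize_termAlgebra]
  exact Term.realize_quotient_mk' (ps := presPrestructure Λ R) _ t v

omit [L.IsAlgebraic] in
theorem subst_var (t : L.Term X) : t.subst Term.var = t := by
  induction t with
  | var => rfl
  | func f ts ih => simp only [Term.subst, ih]

theorem mk_eq_realize (R : Set (L.Term X × L.Term X)) (t : L.Term X) :
    (⟦t⟧ : Presented Λ R) = t.realize fun x => (⟦Term.var x⟧ : Presented Λ R) := by
  rw [realize_mk, subst_var]

theorem inVariety_presented (R : Set (L.Term X × L.Term X)) : InVariety Λ (Presented Λ R) := by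
  intro q hq a
  obtain ⟨t, rfl⟩ : ∃ t : ℕ → L.Term X, a = fun i => ⟦t i⟧ :=
    ⟨fun i => (a i).out, funext fun i => (Quotient.out_eq _).symm⟩
  rw [realize_mk, realize_mk]
  exact Quotient.sound ((isLawfulCongruence_presCongr R).2 q hq t)

/-- Together with `presCongr_le` this is the universal property: a map of generators into an algebra
of the variety extends as soon as it respects the defining equations. -/
theorem isLawfulCongruence_ker_realize {A : Type*} [L.Structure A] (hA : InVariety Λ A)
    (v : X → A) : IsLawfulCongruence Λ (Setoid.ker fun t : L.Term X => t.realize v) := by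
  refine ⟨?_, fun q hq t => ?_⟩
  · intro k f a b h
    change funMap f (fun i => (a i).realize v) = funMap f fun i => (b i).realize v
    congr 1
    exact funext h
  · change (q.1.subst t).realize v = (q.2.subst t).realize v
    rw [Term.realize_subst, Term.realize_subst]
    exact hA q hq _

/-- The homomorphism from a presented algebra given by the images of the generators. -/
noncomputable def Presented.lift {R : Set (L.Term X × L.Term X)} {A : Type*} [L.Structure A]
    (v : X → A) (h : presCongr Λ R ≤ Setoid.ker fun t : L.Term X => t.realize v) :
    Presented Λ R →[L] A where
  toFun := Quotient.lift (fun t => t.realize v) fun _ _ hab => h hab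
  map_fun' {k} f x := by
    obtain ⟨t, rfl⟩ : ∃ t : Fin k → L.Term X, x = fun i => ⟦t i⟧ :=
      ⟨fun i => (x i).out, funext fun i => (Quotient.out_eq _).symm⟩
    rw [funMap_quotient_mk']
    rfl
  map_rel' r _ := isEmptyElim r

theorem Presented.map_mk {R : Set (L.Term X × L.Term X)} {A : Type*} [L.Structure A]
    (φ : Presented Λ R →[L] A) (t : L.Term X) :
    φ ⟦t⟧ = t.realize fun x => φ ⟦Term.var x⟧ := by
  rw [mk_eq_realize, ← HomClass.realize_term]
  rfl

/-- The congruence of the term algebra induced by a homomorphism from a presented algebra. -/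
def Presented.ker {R : Set (L.Term X × L.Term X)} {A : Type*} [L.Structure A]
    (φ : Presented Λ R →[L] A) : Setoid (L.Term X) :=
  Setoid.ker fun t => φ ⟦t⟧

theorem Presented.ker_eq {R : Set (L.Term X × L.Term X)} {A : Type*} [L.Structure A]
    (φ : Presented Λ R →[L] A) :
    Presented.ker φ = Setoid.ker fun t : L.Term X => t.realize fun x => φ ⟦Term.var x⟧ := by
  unfold Presented.ker
  congr 1
  exact funext fun t => Presented.map_mk φ t

theorem Presented.isLawfulCongruence_ker {R : Set (L.Term X × L.Term X)} {A : Type*}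
    [L.Structure A] (hA : InVariety Λ A) (φ : Presented Λ R →[L] A) :
    IsLawfulCongruence Λ (Presented.ker φ) := by
  rw [Presented.ker_eq]
  exact isLawfulCongruence_ker_realize hA _

theorem Presented.presCongr_le_ker {R : Set (L.Term X × L.Term X)} {A : Type*} [L.Structure A]
    (φ : Presented Λ R →[L] A) : presCongr Λ R ≤ Presented.ker φ :=
  fun _ _ h => congrArg φ (Quotient.sound h)

theorem Presented.injective_iff {R : Set (L.Term X × L.Term X)} {A : Type*} [L.Structure A]
    (φ : Presented Λ R →[L] A) : Function.Injective φ ↔ Presented.ker φ = presCongr Λ R := by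
  refine ⟨fun h => le_antisymm (fun a b hab => ?_) (Presented.presCongr_le_ker φ), fun h => ?_⟩
  · exact Quotient.exact (h hab)
  · intro x y
    induction x using Quotient.inductionOn
    induction y using Quotient.inductionOn
    intro hxy
    refine Quotient.sound ?_
    change presCongr Λ R _ _
    rw [← h]
    exact hxy

/-- A surjective homomorphism from a presented algebra presents its target by its kernel. -/
theorem Presented.nonempty_equiv_of_ker {R S : Set (L.Term X × L.Term X)} {A : Type*}
    [L.Structure A] (φ : Presented Λ R →[L] A) (hφ : Function.Surjective φ)
    (h : presCongr Λ S = Presented.ker φ) : Nonempty (Presented Λ S ≃[L] A) := by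
  have h' := h.trans (Presented.ker_eq φ)
  let ψ : Presented Λ S →[L] A := Presented.lift _ h'.le
  have hψ : ∀ t : L.Term X, ψ ⟦t⟧ = φ ⟦t⟧ := fun t => (Presented.map_mk φ t).symm
  refine ⟨equivOfBijective ψ ⟨?_, fun a => ?_⟩⟩
  · rw [Presented.injective_iff, h]
    unfold Presented.ker
    congr 1
    exact funext hψ
  · obtain ⟨x, rfl⟩ := hφ a
    induction x using Quotient.inductionOn with
    | h t => exact ⟨⟦t⟧, hψ t⟩

theorem Presented.nonempty_equiv_of_presCongr_eq {R S : Set (L.Term X × L.Term X)}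
    (h : presCongr Λ R = presCongr Λ S) : Nonempty (Presented Λ R ≃[L] Presented Λ S) := by
  refine Presented.nonempty_equiv_of_ker (Hom.id L _) (fun x => ⟨x, rfl⟩) ?_
  rw [h]
  exact ((Presented.injective_iff _).1 fun _ _ hxy => hxy).symm

theorem Presented.exists_surjective_of_le {R S : Set (L.Term X × L.Term X)}
    (h : presCongr Λ R ≤ presCongr Λ S) :
    ∃ φ : Presented Λ R →[L] Presented Λ S, Function.Surjective φ ∧ ∀ t, φ ⟦t⟧ = ⟦t⟧ := by
  have key : ∀ t : L.Term X, t.realize (fun x => (⟦Term.var x⟧ : Presented Λ S)) = ⟦t⟧ :=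
    fun t => (mk_eq_realize S t).symm
  refine ⟨Presented.lift (fun x => ⟦Term.var x⟧) fun a b hab => ?_, fun x => ?_, key⟩
  · change a.realize _ = b.realize _
    rw [key, key]
    exact Quotient.sound (h hab)
  · induction x using Quotient.inductionOn with
    | h t => exact ⟨⟦t⟧, key t⟩

/-- The ascending chain condition for an algebra, in terms of the congruences of the term algebra
above the one that presents it. -/
theorem HasACC.wellFoundedGT {R : Set (L.Term X × L.Term X)} (h : HasACC L (Presented Λ R)) :
    WellFoundedGT {s : Setoid (L.Term X) // IsLawfulCongruence Λ s ∧ presCongr Λ R ≤ s} := by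
  rw [HasACC, ← wellFoundedGT_iff_monotone_chain_condition] at h
  let F : {s : Setoid (L.Term X) // IsLawfulCongruence Λ s ∧ presCongr Λ R ≤ s} →
      CongruenceLattice L (Presented Λ R) := fun s =>
    ⟨Setoid.correspondence _ ⟨s.1, s.2.2⟩, by
      intro k f a b hab
      obtain ⟨t, rfl⟩ : ∃ t : Fin k → L.Term X, a = fun i => ⟦t i⟧ :=
        ⟨fun i => (a i).out, funext fun i => (Quotient.out_eq _).symm⟩
      obtain ⟨t', rfl⟩ : ∃ t : Fin k → L.Term X, b = fun i => ⟦t i⟧ :=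
        ⟨fun i => (b i).out, funext fun i => (Quotient.out_eq _).symm⟩
      rw [funMap_quotient_mk', funMap_quotient_mk']
      exact s.2.1.1 f t t' hab⟩
  have hF : StrictMono F := fun s t hst =>
    (Setoid.correspondence _).strictMono (a := ⟨s.1, s.2.2⟩) (b := ⟨t.1, t.2.2⟩) hst
  exact hF.wellFoundedGT

end Presentations

/-! ### Indices, finite stages and the recursion theorem for c.e. sets -/

section CeSets

theorem W_encode (c : Code) : W (Encodable.encode c) = {x | (c.eval x).Dom} := by
  simp [W]

/-- A uniformly partial computable family of domains is a computable family of c.e. sets. -/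
theorem exists_computable_W_eq {f : ℕ → ℕ →. ℕ} (hf : Partrec₂ f) :
    ∃ g : ℕ → ℕ, Computable g ∧ ∀ e, W (g e) = {x | (f e x).Dom} := by
  have h : Partrec fun a : ℕ => f a.unpair.1 a.unpair.2 :=
    hf.comp (Computable.fst.comp Primrec.unpair.to_comp) (Computable.snd.comp Primrec.unpair.to_comp)
  obtain ⟨c, hc⟩ := Code.exists_code.1 (Partrec.nat_iff.1 h)
  refine ⟨fun e => Encodable.encode (c.curry e), ?_, fun e => ?_⟩
  · exact (Primrec.encode.comp
      (Code.primrec₂_curry.comp (Primrec.const c) Primrec.id)).to_comp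
  · rw [W_encode]
    ext x
    simp [Code.eval_curry, hc]

theorem exists_W_eq_empty : ∃ e, W e = ∅ := by
  obtain ⟨g, -, hg⟩ := exists_computable_W_eq (f := fun _ _ => Part.none) Partrec.none
  exact ⟨g 0, by rw [hg]; simp⟩

/-- The part of the `e`-th c.e. set that is enumerated by stage `s`. -/
def stage (e s : ℕ) : List ℕ :=
  (List.range s).filter fun c => (Code.evaln s (Denumerable.ofNat Code e) c).isSome

theorem computable_stage : Computable₂ stage := by
  have hR : PrimrecRel fun (c : ℕ) (a : ℕ × ℕ) =>
      ((Code.evaln a.2 (Denumerable.ofNat Code a.1) c).isSome = true) := by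
    refine Primrec.primrecPred ?_
    exact (Primrec.option_isSome.comp (Code.primrec_evaln.comp
      (Primrec.pair (Primrec.pair (Primrec.snd.comp Primrec.snd)
        ((Primrec.ofNat Code).comp (Primrec.fst.comp Primrec.snd))) Primrec.fst))).of_eq
      fun a => by simp
  have := (hR.listFilter.comp (Primrec.list_range.comp Primrec.snd) Primrec.id :
    Primrec fun a : ℕ × ℕ => (List.range a.2).filter fun c =>
      (Code.evaln a.2 (Denumerable.ofNat Code a.1) c).isSome = true)
  exact (this.of_eq fun a => by simp [stage]).to_comp

theorem monotone_stage (e : ℕ) : Monotone fun s => {c | c ∈ stage e s} := by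
  intro s t hst c hc
  simp only [stage, Set.mem_ofPred_eq, List.mem_filter, List.mem_range,
    Option.isSome_iff_exists] at hc ⊢
  obtain ⟨h1, x, hx⟩ := hc
  exact ⟨h1.trans_le hst, x, Code.evaln_mono hst hx⟩

theorem iUnion_stage (e : ℕ) : ⋃ s, {c | c ∈ stage e s} = W e := by
  ext c
  simp only [stage, Set.mem_iUnion, Set.mem_ofPred_eq, List.mem_filter, List.mem_range,
    Option.isSome_iff_exists, W, Part.dom_iff_mem]
  constructor
  · rintro ⟨s, -, x, hx⟩
    exact ⟨x, Code.evaln_complete.2 ⟨s, hx⟩⟩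
  · rintro ⟨x, hx⟩
    obtain ⟨s, hs⟩ := Code.evaln_complete.1 hx
    -- `evaln s` converges only on inputs below `s`, so the cutoff `List.range s` in `stage` loses
    -- nothing.
    exact ⟨s, Code.evaln_bound hs, x, hs⟩

/-- By the recursion theorem, a c.e. set can enumerate `R` and, once a computable condition on
its own index has been met, also `R'`. -/
theorem exists_W_eq_of_trigger {q : ℕ → ℕ → Bool} (hq : Computable₂ q) (R R' : List ℕ) :
    ∃ i, W i = {c | c ∈ R ∨ c ∈ R' ∧ ∃ s, q i s = true} := by
  have hmem : ∀ l : List ℕ, Computable fun c : ℕ => decide (c ∈ l) := by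
    intro l
    have h : PrimrecRel fun (l : List ℕ) (c : ℕ) => ∃ a ∈ l, a = c :=
      PrimrecRel.exists_mem_list Primrec.eq
    have h2 : PrimrecPred fun c : ℕ => c ∈ l :=
      (h.comp (Primrec.const l) Primrec.id).of_eq fun c => by simp
    exact h2.decide.to_comp
  let p : Code × ℕ → ℕ → Bool := fun a s =>
    decide (a.2 ∈ R) || (decide (a.2 ∈ R') && q (Encodable.encode a.1) s)
  have hp : Computable₂ p := by
    refine Primrec.or.to_comp.comp ((hmem R).comp (Computable.snd.comp Computable.fst)) ?_
    refine Primrec.and.to_comp.comp ((hmem R').comp (Computable.snd.comp Computable.fst)) ?_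
    exact hq.comp (Computable.encode.comp (Computable.fst.comp Computable.fst)) Computable.snd
  obtain ⟨c, hc⟩ := Code.fixed_point₂ (f := fun c x => Nat.rfind (PFun.lift (p (c, x))))
    (Partrec.rfind hp.partrec₂)
  refine ⟨Encodable.encode c, ?_⟩
  rw [W_encode]
  ext x
  rw [Set.mem_ofPred_eq, hc, Nat.rfind_dom']
  simp [p, PFun.lift, exists_or]

end CeSets

/-! ### Gödel numbers, and the chain condition for coded presentations -/

section Coding

variable {L : FirstOrder.Language.{u, v}} {m : ℕ} (ε : (Σ k, L.Functions k) ≃ Fin m)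

theorem termCode_injective {n : ℕ} : Function.Injective (termCode ε (n := n)) := by
  intro s t h
  have h1 := Encodable.encode_injective h
  have h2 : s.listEncode = t.listEncode :=
    List.map_injective_iff.2 (Function.injective_id.sumMap ε.injective) h1
  have h3 := congrArg Term.listDecode h2
  have h4 : ∀ t : L.Term (Fin n), Term.listDecode t.listEncode = [t] := fun t => by
    simpa using Term.listDecode_encode_list [t]
  simpa [h4] using h3

theorem eqCode_injective {n : ℕ} : Function.Injective (eqCode ε (n := n)) := by
  intro p q h
  have := Nat.pair_eq_pair.1 h
  exact Prod.ext (termCode_injective ε this.1) (termCode_injective ε this.2)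

theorem listEncode_relabel {α β : Type*} (g : α → β) (t : L.Term α) :
    (t.relabel g).listEncode = t.listEncode.map (Sum.map g id) := by
  induction t with
  | var => rfl
  | func f ts ih =>
    simp [Term.listEncode, Term.relabel, List.map_flatMap, ih]

/-- The effect on Gödel numbers of terms of renaming the generators. -/
def termCodeMap (m : ℕ) {k l : ℕ} (g : Fin k → Fin l) (a : ℕ) : ℕ :=
  -- The default `[]` is never reached on codes of terms, and numbers that code no equation do not
  -- affect a presented algebra.
  Encodable.encode (((Encodable.decode a : Option (List (Fin k ⊕ Fin m))).getD []).map (Sum.map g id))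

/-- The effect on Gödel numbers of equations of renaming the generators. -/
def eqCodeMap (m : ℕ) {k l : ℕ} (g : Fin k → Fin l) (a : ℕ) : ℕ :=
  Nat.pair (termCodeMap m g a.unpair.1) (termCodeMap m g a.unpair.2)

theorem termCodeMap_termCode {k l : ℕ} (g : Fin k → Fin l) (t : L.Term (Fin k)) :
    termCodeMap m g (termCode ε t) = termCode ε (t.relabel g) := by
  simp only [termCodeMap, termCode, Encodable.encodek, Option.getD_some, listEncode_relabel,
    List.map_map]
  congr 2
  funext x
  cases x <;> rfl

theorem eqCodeMap_eqCode {k l : ℕ} (g : Fin k → Fin l) (p : L.Term (Fin k) × L.Term (Fin k)) :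
    eqCodeMap m g (eqCode ε p) = eqCode ε (p.1.relabel g, p.2.relabel g) := by
  simp [eqCodeMap, eqCode, termCodeMap_termCode]

theorem computable_eqCodeMap {k l : ℕ} (g : Fin k → Fin l) : Computable (eqCodeMap m g) := by
  have h : Primrec (termCodeMap m g) :=
    Primrec.encode.comp (Primrec.list_map
      (Primrec.option_getD.comp Primrec.decode (Primrec.const []))
      ((Primrec.dom_finite (Sum.map g (id : Fin m → Fin m))).comp Primrec.snd).to₂)
  exact (Primrec₂.natPair.comp (h.comp (Primrec.fst.comp Primrec.unpair))
    (h.comp (Primrec.snd.comp Primrec.unpair))).to_comp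

variable [L.IsAlgebraic] {Λ : Set (L.Term ℕ × L.Term ℕ)}

/-- An index of the empty set presents the free algebra, whose congruences correspond to all lawful
congruences of the term algebra. -/
theorem FinitelyGeneratedACC.wellFoundedGT (h : FinitelyGeneratedACC ε Λ) {k : ℕ} (hk : 1 ≤ k) :
    WellFoundedGT {s : Setoid (L.Term (Fin k)) // IsLawfulCongruence Λ s} := by
  obtain ⟨e, he⟩ := exists_W_eq_empty
  have := (h k e hk).wellFoundedGT
  have hle : ∀ s : {s : Setoid (L.Term (Fin k)) // IsLawfulCongruence Λ s},
      presCongr Λ {p | eqCode ε p ∈ W e} ≤ s.1 := fun s =>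
    presCongr_le s.2 fun p hp => by simp [he] at hp
  have hF : StrictMono fun s : {s : Setoid (L.Term (Fin k)) // IsLawfulCongruence Λ s} =>
      (⟨s.1, s.2, hle s⟩ : {s : Setoid (L.Term (Fin k)) //
        IsLawfulCongruence Λ s ∧ presCongr Λ {p | eqCode ε p ∈ W e} ≤ s}) := fun _ _ h => h
  exact hF.wellFoundedGT

/-- A presentation that is the union of an ascending sequence is equivalent to one of its
members. -/
theorem FinitelyGeneratedACC.exists_presCongr_eq (h : FinitelyGeneratedACC ε Λ) {k : ℕ}
    (hk : 1 ≤ k) {S : ℕ → Set ℕ} (hS : Monotone S) :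
    ∃ N, presCongr Λ {p : L.Term (Fin k) × L.Term (Fin k) | eqCode ε p ∈ S N} =
      presCongr Λ {p | eqCode ε p ∈ ⋃ s, S s} := by
  have hwf := h.wellFoundedGT ε hk
  rw [wellFoundedGT_iff_monotone_chain_condition] at hwf
  obtain ⟨N, hN⟩ := hwf ⟨fun s => ⟨presCongr Λ {p | eqCode ε p ∈ S s},
    isLawfulCongruence_presCongr _⟩, fun s t hst => presCongr_mono fun p hp => hS hst hp⟩
  refine ⟨N, le_antisymm (presCongr_mono fun p hp => Set.mem_iUnion.2 ⟨N, hp⟩)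
    (presCongr_le (isLawfulCongruence_presCongr _) fun p hp => ?_)⟩
  obtain ⟨s, hs⟩ := Set.mem_iUnion.1 hp
  have h1 := congrArg Subtype.val (hN (max N s) (le_max_left _ _))
  change presCongr Λ {p | eqCode ε p ∈ S N} = presCongr Λ {p | eqCode ε p ∈ S (max N s)} at h1
  rw [h1]
  exact presCongr_of_mem (Λ := Λ) (R := {p | eqCode ε p ∈ S (max N s)})
    (hS (le_max_right N s) hs)

/-- Every quotient of a finitely generated free algebra of the variety is finitely presented. -/
theorem FinitelyGeneratedACC.exists_list (h : FinitelyGeneratedACC ε Λ) {k : ℕ}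
    (hk : 1 ≤ k) {s : Setoid (L.Term (Fin k))} (hs : IsLawfulCongruence Λ s) :
    ∃ R : List ℕ, presCongr Λ {p | eqCode ε p ∈ {c | c ∈ R}} = s := by
  classical
  -- These finite sets exhaust the equations of `s`, so the chain stops at one of them. Nothing here
  -- is effective: `s` need not be c.e.
  let S : ℕ → Set ℕ := fun j => {c | c < j ∧ ∃ p, s p.1 p.2 ∧ eqCode ε p = c}
  have hS : Monotone S := fun i j hij c hc => ⟨hc.1.trans_le hij, hc.2⟩
  obtain ⟨N, hN⟩ := h.exists_presCongr_eq ε hk hS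
  refine ⟨(List.range N).filter fun c => ∃ p, s p.1 p.2 ∧ eqCode ε p = c, ?_⟩
  have h1 : {c | c ∈ (List.range N).filter fun c => ∃ p, s p.1 p.2 ∧ eqCode ε p = c} = S N := by
    ext c
    simp [S]
  rw [h1, hN]
  refine le_antisymm (presCongr_le hs fun p hp => ?_) fun a b hab => ?_
  · obtain ⟨j, -, q, hq, hqp⟩ := Set.mem_iUnion.1 hp
    rwa [← eqCode_injective ε hqp]
  · exact presCongr_of_mem (Λ := Λ) (p := (a, b)) (R := {p | eqCode ε p ∈ ⋃ s, S s})
      (Set.mem_iUnion.2 ⟨eqCode ε (a, b) + 1, Nat.lt_succ_self _, (a, b), hab, rfl⟩)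

end Coding

/-! ### The reduction from `n` to `n + 1` generators and the diagonal argument against its converse
-/

section Main

variable {L : FirstOrder.Language.{u, v}} [L.IsAlgebraic] {m : ℕ}
  (ε : (Σ k, L.Functions k) ≃ Fin m) {Λ : Set (L.Term ℕ × L.Term ℕ)}

/-- The map of generators that sends the last generator to the first and fixes the others. -/
def collapseLast {n : ℕ} (hn : 1 ≤ n) (i : Fin (n + 1)) : Fin n :=
  if h : i.val < n then ⟨i.val, h⟩ else ⟨0, hn⟩

theorem collapseLast_castSucc {n : ℕ} (hn : 1 ≤ n) (i : Fin n) :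
    collapseLast hn i.castSucc = i := by
  simp [collapseLast]

theorem collapseLast_last {n : ℕ} (hn : 1 ≤ n) : collapseLast hn (Fin.last n) = ⟨0, hn⟩ := by
  simp [collapseLast]

/-- Adding a generator and an equation that identifies it with the first generator does not change
the presented algebra. -/
theorem nonempty_equiv_collapseLast {n : ℕ} (hn : 1 ≤ n) (S : Set ℕ) :
    Nonempty (AlgebraOn ε Λ (n + 1)
        {c | c = eqCode ε (Term.var (Fin.last n), Term.var (Fin.castSucc ⟨0, hn⟩)) ∨
          eqCodeMap m (collapseLast hn) c ∈ S} ≃[L]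
      AlgebraOn ε Λ n S) := by
  set S' : Set ℕ := {c | c = eqCode ε (Term.var (Fin.last n), Term.var (Fin.castSucc ⟨0, hn⟩)) ∨
    eqCodeMap m (collapseLast hn) c ∈ S} with hS'
  let v : Fin (n + 1) → AlgebraOn ε Λ n S := fun i => ⟦Term.var (collapseLast hn i)⟧
  let v' : Fin n → AlgebraOn ε Λ (n + 1) S' := fun i => ⟦Term.var i.castSucc⟧
  have hv : ∀ t : L.Term (Fin (n + 1)), t.realize v = ⟦t.relabel (collapseLast hn)⟧ := fun t => by
    rw [mk_eq_realize, Term.realize_relabel]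
    rfl
  have hv' : ∀ t : L.Term (Fin n), t.realize v' = ⟦t.relabel Fin.castSucc⟧ := fun t => by
    rw [mk_eq_realize, Term.realize_relabel]
    rfl
  let α : AlgebraOn ε Λ (n + 1) S' →[L] AlgebraOn ε Λ n S := Presented.lift v <|
    presCongr_le (isLawfulCongruence_ker_realize (inVariety_presented _) v) fun p hp => by
      change p.1.realize v = p.2.realize v
      rcases hp with hp | hp
      · rw [eqCode_injective ε hp]
        change v _ = v _
        simp only [v, collapseLast_last, collapseLast_castSucc]
      · rw [hv, hv]
        rw [eqCodeMap_eqCode] at hp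
        exact Quotient.sound (presCongr_of_mem (Λ := Λ) (R := {p | eqCode ε p ∈ S}) hp)
  let β : AlgebraOn ε Λ n S →[L] AlgebraOn ε Λ (n + 1) S' := Presented.lift v' <|
    presCongr_le (isLawfulCongruence_ker_realize (inVariety_presented _) v') fun p hp => by
      change p.1.realize v' = p.2.realize v'
      rw [hv', hv']
      refine Quotient.sound (presCongr_of_mem (Λ := Λ) (R := {p | eqCode ε p ∈ S'})
        (p := (p.1.relabel Fin.castSucc, p.2.relabel Fin.castSucc)) (Or.inr ?_))
      have h : collapseLast hn ∘ Fin.castSucc = id := funext (collapseLast_castSucc hn)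
      rw [eqCodeMap_eqCode, Term.relabel_relabel, Term.relabel_relabel, h, Term.relabel_id,
        Term.relabel_id]
      exact hp
  have hβα : ∀ x, β (α x) = x := by
    intro x
    induction x using Quotient.inductionOn with
    | h t =>
      change (β.comp α) ⟦t⟧ = ⟦t⟧
      rw [Presented.map_mk, mk_eq_realize]
      congr 1
      funext i
      change (⟦Term.var (collapseLast hn i).castSucc⟧ : AlgebraOn ε Λ (n + 1) S') = ⟦Term.var i⟧
      induction i using Fin.lastCases with
      | last =>
        rw [collapseLast_last]
        exact (Quotient.sound (presCongr_of_mem (Λ := Λ) (R := {p | eqCode ε p ∈ S'})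
          (p := (Term.var (Fin.last n), Term.var (Fin.castSucc ⟨0, hn⟩))) (Or.inl rfl))).symm
      | cast i => rw [collapseLast_castSucc]
  refine ⟨equivOfBijective α ⟨Function.LeftInverse.injective hβα, fun x => ?_⟩⟩
  induction x using Quotient.inductionOn with
  | h t =>
    refine ⟨β ⟦t⟧, ?_⟩
    change (α.comp β) ⟦t⟧ = ⟦t⟧
    rw [Presented.map_mk, mk_eq_realize]
    congr 1
    funext i
    change (⟦Term.var (collapseLast hn i.castSucc)⟧ : AlgebraOn ε Λ n S) = ⟦Term.var i⟧
    rw [collapseLast_castSucc]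

theorem isoRel_iff {n e i : ℕ} :
    isoRel ε Λ n e i ↔ Nonempty (AlgebraOn ε Λ n (W e) ≃[L] AlgebraOn ε Λ n (W i)) :=
  Iff.rfl

theorem computablyReducible_isoRel_succ {n : ℕ} (hn : 1 ≤ n) :
    ComputablyReducible (isoRel ε Λ n) (isoRel ε Λ (n + 1)) := by
  let c₀ := eqCode ε (Term.var (Fin.last n), Term.var (Fin.castSucc ⟨0, hn⟩))
  -- The domain of `f e` is the set of equations in `nonempty_equiv_collapseLast` for `W e`: halt on
  -- `c₀`, otherwise collapse the last generator and run program `e`.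
  let f : ℕ → ℕ →. ℕ := fun e x => cond (decide (x = c₀)) (Part.some 0)
    ((Denumerable.ofNat Nat.Partrec.Code e).eval (eqCodeMap m (collapseLast hn) x))
  have hf : Partrec₂ f := by
    refine Partrec.cond ?_ (Computable.const 0).partrec ?_
    · exact ((Primrec.eq.comp Primrec.snd (Primrec.const c₀)).decide).to_comp
    · exact Nat.Partrec.Code.eval_part.comp ((Computable.ofNat _).comp Computable.fst)
        ((computable_eqCodeMap _).comp Computable.snd)
  obtain ⟨g, hg, hW⟩ := exists_computable_W_eq hf
  have hiso : ∀ e, Nonempty (AlgebraOn ε Λ (n + 1) (W (g e)) ≃[L] AlgebraOn ε Λ n (W e)) := by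
    intro e
    have h : W (g e) = {c | c = c₀ ∨ eqCodeMap m (collapseLast hn) c ∈ W e} := by
      rw [hW]
      ext x
      by_cases hx : x = c₀ <;> simp [f, hx, W]
    rw [h]
    exact nonempty_equiv_collapseLast ε hn (W e)
  refine ⟨g, hg, fun x y => ?_⟩
  obtain ⟨φ⟩ := hiso x
  obtain ⟨ψ⟩ := hiso y
  rw [isoRel_iff, isoRel_iff]
  exact ⟨fun ⟨χ⟩ => ⟨ψ.symm.comp (χ.comp φ)⟩, fun ⟨χ⟩ => ⟨ψ.comp (χ.comp φ.symm)⟩⟩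

/-- In a nontrivial variety, the free algebra on `n + 1` generators has every `n`-generated algebra
as a proper quotient. -/
theorem exists_surjective_not_injective {n : ℕ} (hn : 1 ≤ n)
    (hΛ : ∃ (A : Type w) (_ : L.Structure A), Nontrivial A ∧ InVariety Λ A) (S : Set ℕ) :
    ∃ φ : AlgebraOn ε Λ (n + 1) ∅ →[L] AlgebraOn ε Λ n S,
      Function.Surjective φ ∧ ¬ Function.Injective φ := by
  obtain ⟨χ⟩ := nonempty_equiv_collapseLast ε (Λ := Λ) hn S
  obtain ⟨φ, hφ, hφt⟩ := Presented.exists_surjective_of_le (Λ := Λ)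
    (presCongr_mono (R := {p : L.Term (Fin (n + 1)) × L.Term (Fin (n + 1)) | eqCode ε p ∈ (∅ : Set ℕ)})
      (S := {p | eqCode ε p ∈ {c | c = eqCode ε (Term.var (Fin.last n),
        Term.var (Fin.castSucc ⟨0, hn⟩)) ∨ eqCodeMap m (collapseLast hn) c ∈ S}})
      fun p hp => hp.elim)
  refine ⟨χ.toHom.comp φ, χ.surjective.comp hφ, fun hinj => ?_⟩
  have hinj : Function.Injective φ := Function.Injective.of_comp (f := χ.toHom) hinj
  have h1 : φ ⟦Term.var (Fin.last n)⟧ = φ ⟦Term.var (Fin.castSucc ⟨0, hn⟩)⟧ := by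
    rw [hφt, hφt]
    exact Quotient.sound (presCongr_of_mem (Λ := Λ)
      (p := (Term.var (Fin.last n), Term.var (Fin.castSucc ⟨0, hn⟩))) (Or.inl rfl))
  have h2 := Quotient.exact (hinj h1)
  obtain ⟨A, _, ⟨a, b, hab⟩, hA⟩ := hΛ
  let v : Fin (n + 1) → A := Fin.lastCases a fun _ => b
  have h3 := presCongr_le (isLawfulCongruence_ker_realize hA v) (fun p hp => hp.elim) h2
  change v (Fin.last n) = v (Fin.castSucc ⟨0, hn⟩) at h3
  simp only [v, Fin.lastCases_last, Fin.lastCases_castSucc] at h3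
  exact hab h3

/-- The diagonal step: a computable reduction that maps an `(n + 1)`-generated algebra to a proper
quotient of it does the same for a smaller algebra. -/
theorem exists_presCongr_lt (hACC : FinitelyGeneratedACC ε Λ) (hIP : DecidableIsoProblem ε Λ)
    {n : ℕ} (hn : 1 ≤ n) {h : ℕ → ℕ} (hc : Computable h)
    (hr : ∀ x y, isoRel ε Λ (n + 1) x y ↔ isoRel ε Λ n (h x) (h y)) {e : ℕ}
    (φ : AlgebraOn ε Λ (n + 1) (W e) →[L] AlgebraOn ε Λ n (W (h e)))
    (hφ : Function.Surjective φ) (hφ' : ¬ Function.Injective φ) :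
    ∃ (i : ℕ) (ψ : AlgebraOn ε Λ (n + 1) (W i) →[L] AlgebraOn ε Λ n (W (h i))),
      Function.Surjective ψ ∧ ¬ Function.Injective ψ ∧
      presCongr Λ {p : L.Term (Fin (n + 1)) × L.Term (Fin (n + 1)) | eqCode ε p ∈ W e} <
        presCongr Λ {p | eqCode ε p ∈ W i} := by
  have hn' : 1 ≤ n + 1 := Nat.le_add_left 1 n
  have hlaw := Presented.isLawfulCongruence_ker (inVariety_presented _) φ
  -- `R`, `R'` and `Q` need not be computable from `e`: they are built into the program for `W i` as
  -- constants.
  obtain ⟨R, hR⟩ := hACC.exists_list ε hn' (isLawfulCongruence_presCongr (Λ := Λ)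
    {p : L.Term (Fin (n + 1)) × L.Term (Fin (n + 1)) | eqCode ε p ∈ W e})
  obtain ⟨R', hR'⟩ := hACC.exists_list ε hn' hlaw
  obtain ⟨Q, hQ⟩ := hACC.exists_list ε hn (isLawfulCongruence_presCongr (Λ := Λ)
    {p : L.Term (Fin n) × L.Term (Fin n) | eqCode ε p ∈ W (h e)})
  obtain ⟨κ⟩ : Nonempty (AlgebraOn ε Λ n {c | c ∈ Q} ≃[L] AlgebraOn ε Λ n (W (h e))) :=
    Presented.nonempty_equiv_of_presCongr_eq hQ
  have hlt : presCongr Λ {p | eqCode ε p ∈ W e} < Presented.ker φ :=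
    lt_of_le_of_ne (Presented.presCongr_le_ker φ)
      fun h => hφ' ((Presented.injective_iff φ).2 h.symm)
  obtain ⟨d, hd, hd'⟩ := hIP
  let q : ℕ → ℕ → Bool := fun i s => d ((n, stage (h i) s), (n, Q))
  have hq : Computable₂ q :=
    hd.comp (Computable.pair (Computable.pair (Computable.const n)
      (computable_stage.comp (hc.comp Computable.fst) Computable.snd)) (Computable.const (n, Q)))
  obtain ⟨i, hi⟩ := exists_W_eq_of_trigger hq R R'
  have htrig : ∃ s, q i s = true := by
    by_contra hno
    have hi' : W i = {c | c ∈ R} := by simp [hi, hno]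
    have h1 : isoRel ε Λ (n + 1) i e := by
      rw [isoRel_iff, hi']
      exact Presented.nonempty_equiv_of_presCongr_eq hR
    obtain ⟨χ⟩ := (hr i e).1 h1
    obtain ⟨s, hs⟩ := hACC.exists_presCongr_eq ε hn (monotone_stage (h i))
    rw [iUnion_stage] at hs
    obtain ⟨τ⟩ : Nonempty (AlgebraOn ε Λ n {c | c ∈ stage (h i) s} ≃[L]
      AlgebraOn ε Λ n (W (h i))) := Presented.nonempty_equiv_of_presCongr_eq hs
    exact hno ⟨s, (hd' _ _ _ _ hn hn).2 ⟨κ.symm.comp (χ.comp τ)⟩⟩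
  have hi' : presCongr Λ {p | eqCode ε p ∈ W i} = Presented.ker φ := by
    refine le_antisymm (presCongr_le hlaw fun p hp => ?_) ?_
    · simp only [hi, Set.mem_ofPred_eq] at hp
      rcases hp with hp | ⟨hp, -⟩
      · apply hlt.le
        rw [← hR]
        exact presCongr_of_mem (R := {p | eqCode ε p ∈ {c | c ∈ R}}) hp
      · rw [← hR']
        exact presCongr_of_mem (R := {p | eqCode ε p ∈ {c | c ∈ R'}}) hp
    · rw [← hR']
      refine presCongr_mono fun p hp => ?_
      simp only [hi, Set.mem_ofPred_eq]
      exact Or.inr ⟨hp, htrig⟩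
  obtain ⟨s, hs⟩ := htrig
  obtain ⟨ρ⟩ := (hd' _ _ _ _ hn hn).1 hs
  obtain ⟨σ, hσ, -⟩ := Presented.exists_surjective_of_le (Λ := Λ)
    (presCongr_mono (R := {p : L.Term (Fin n) × L.Term (Fin n) | eqCode ε p ∈ {c | c ∈ stage (h i) s}})
      (S := {p | eqCode ε p ∈ W (h i)}) fun p hp => by
        rw [Set.mem_ofPred_eq, ← iUnion_stage]
        exact Set.mem_iUnion.2 ⟨s, hp⟩)
  obtain ⟨τ⟩ := Presented.nonempty_equiv_of_ker φ hφ hi'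
  -- The stage that fired the trigger presents a copy of the algebra of `h e`; whatever `W (h i)`
  -- enumerates later can only pass to a quotient of it.
  let π : AlgebraOn ε Λ n (W (h e)) →[L] AlgebraOn ε Λ n (W (h i)) :=
    σ.comp (ρ.symm.toHom.comp κ.symm.toHom)
  have hπ : Function.Surjective π := hσ.comp (ρ.symm.surjective.comp κ.symm.surjective)
  have hπ' : ¬ Function.Injective π := by
    intro hinj
    obtain ⟨χ⟩ := (hr e i).2 ⟨equivOfBijective π ⟨hinj, hπ⟩⟩
    -- Were `π` injective, `h` would make `e` and `i` isomorphic, and `φ` would become a surjective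
    -- endomorphism with nontrivial kernel.
    let η : AlgebraOn ε Λ (n + 1) (W e) →[L] AlgebraOn ε Λ (n + 1) (W e) :=
      (χ.symm.toHom.comp τ.symm.toHom).comp φ
    have hη : Function.Injective η := (hACC (n + 1) e hn').injective_of_surjective η
      ((χ.symm.surjective.comp τ.symm.surjective).comp hφ)
    exact hφ' (Function.Injective.of_comp
      (f := χ.symm.toHom.comp τ.symm.toHom) hη)
  refine ⟨i, π.comp τ.toHom, hπ.comp τ.surjective, fun hinj => hπ' ?_, by rwa [hi']⟩
  exact (Function.Injective.of_comp_iff' π τ.bijective).1 hinj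

theorem not_computablyReducible_isoRel_succ (hACC : FinitelyGeneratedACC ε Λ)
    (hIP : DecidableIsoProblem ε Λ)
    (hΛ : ∃ (A : Type w) (_ : L.Structure A), Nontrivial A ∧ InVariety Λ A)
    {n : ℕ} (hn : 1 ≤ n) : ¬ ComputablyReducible (isoRel ε Λ (n + 1)) (isoRel ε Λ n) := by
  rintro ⟨h, hc, hr⟩
  have hwf := hACC.wellFoundedGT ε (Nat.le_add_left 1 n)
  -- The induction runs downwards from large congruences and quantifies over every index `e`
  -- presenting `s`, since the diagonal step changes the index.
  have key : ∀ (s : {s : Setoid (L.Term (Fin (n + 1))) // IsLawfulCongruence Λ s}) (e : ℕ),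
      presCongr Λ {p : L.Term (Fin (n + 1)) × L.Term (Fin (n + 1)) | eqCode ε p ∈ W e} = s.1 →
      ∀ φ : AlgebraOn ε Λ (n + 1) (W e) →[L] AlgebraOn ε Λ n (W (h e)),
        Function.Surjective φ → Function.Injective φ := by
    intro s
    induction s using hwf.induction with
    | ind s ih =>
      intro e he φ hφ
      by_contra hφ'
      obtain ⟨i, ψ, hψ, hψ', hlt⟩ := exists_presCongr_lt ε hACC hIP hn hc hr φ hφ hφ'
      rw [he] at hlt
      exact hψ' (ih ⟨_, isLawfulCongruence_presCongr _⟩ hlt i rfl ψ hψ)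
  obtain ⟨e, he⟩ := exists_W_eq_empty
  have hfree := exists_surjective_not_injective ε hn hΛ (W (h e))
  rw [← he] at hfree
  obtain ⟨φ, hφ, hφ'⟩ := hfree
  exact hφ' (key ⟨_, isLawfulCongruence_presCongr _⟩ e rfl φ hφ)

end Main

end CeAlgebra

theorem mainTheorem8 {L : FirstOrder.Language.{u, v}} [L.IsAlgebraic]
    {m : ℕ} (ε : (Σ k, L.Functions k) ≃ Fin m)
    (Λ : Set (L.Term ℕ × L.Term ℕ))
    (hnontrivial : ∃ (A : Type w) (_ : L.Structure A), Nontrivial A ∧ CeAlgebra.InVariety Λ A)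
    (hACC : CeAlgebra.FinitelyGeneratedACC ε Λ)
    (hIP : CeAlgebra.DecidableIsoProblem ε Λ)
    (n : ℕ) (hn : 1 ≤ n) :
    CeAlgebra.StrictlyBelow (CeAlgebra.isoRel ε Λ n) (CeAlgebra.isoRel ε Λ (n + 1)) :=
  ⟨CeAlgebra.computablyReducible_isoRel_succ ε hn,
    CeAlgebra.not_computablyReducible_isoRel_succ ε hACC hIP hnontrivial hn⟩
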